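/- Let $G=(V,E_{\to},E_{\leftrightarrow})$ be a finite mixed graph without self-loops. Write $\mathrm{pa}(i)=\{j: j\to i\}$ and $\mathrm{sib}(i)=\{j: j\leftrightarrow i\}$. Let $\mathbf B(G)$ be the set of real $V\times V$ matrices $B=(\beta_{ij})$ with $I-B$ invertible and $\beta_{ij}=0$ whenever $j\to i\notin E_{\to}$, and let $\mathbf\Omega(G)$ be the set of symmetric positive definite real $V\times V$ matrices $\Omega=(\omega_{ij})$ with $\omega_{ij}=0$ whenever $i\neq j$ and $j\leftrightarrow i\notin E_{\leftrightarrow}$. The model $\mathbf N(G)$ is the family of normal distributions $\mathcal N(0,\Sigma(B,\Omega))$ with $\Sigma(B,\Omega)=(I-B)^{-1}\Omega(I-B)^{-T}$, $(B,\Omega)\in\mathbf B(G)\times\mathbf\Omega(G)$; its parameters are identifiable if the map $(B,\Omega)\mapsto\mathcal N(0,\Sigma(B,\Omega))$ is injective on $\mathbf B(G)\times\mathbf\Omega(G)$. A half-collider path is a path $i_1,\dots,i_k$ ($k\ge1$, vertices not necessarily distinct) in which either all edges are bi-directed, or the first edge is $i_1\to i_2$ and all other edges are bi-directed; its bi-directed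 portion is $\{i_1,\dots,i_k\}$ in the first case and $\{i_2,\dots,i_k\}$ in the second. A system of half-collider paths from $S_b$ to $S_e$, where $|S_b|=|S_e|=s$, consists of $s$ half-collider paths, each from a node in $S_b$ to a node in $S_e$, such that every node in $S_b$ is the first node of some path and every node in $S_e$ is the last node of some path. Consider the condition: (a) For all $i\in V$, the induced subgraph $G_{-i}$ on $V\setminus\{i\}$ contains a system of half-collider paths from a subset of $V\setminus(\mathrm{pa}(i)\cup\{i\})$ to $\mathrm{sib}(i)$ whose bi-directed portions are pairwise disjoint. If (a) fails for $G$, then the parameters $(B,\Omega)$ of the model $\mathbf N(G)$ are not identifiable. More precisely, in that case, for every $(B,\Omega)\in\mathbf B(G)\times\mathbf\Omega(G)$ there are infinitely many $(B',\Omega')\in\mathbf B(G)\times\mathbf\Omega(G)$ with $\Sigma(B',\Omega')=\Sigma(B,\Omega)$. -/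

import Mathlib

/-- A mixed graph on the vertex set `V`, without self-loops: `dir i j` means `i → j`, and
`bidir.Adj i j` means `i ↔ j`. -/
structure MixedGraph (V : Type*) where
  dir : V → V → Prop
  dir_irrefl : ∀ i, ¬ dir i i
  bidir : SimpleGraph V

namespace MixedGraph

variable {V : Type*}

/-- The parents of `i`. -/
def pa (G : MixedGraph V) (i : V) : Set V := {j | G.dir j i}

/-- The siblings of `i`. -/
def sib (G : MixedGraph V) (i : V) : Set V := {j | G.bidir.Adj j i}

/-- The induced subgraph on a set of vertices. -/
def induce (G : MixedGraph V) (s : Set V) : MixedGraph s where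
  dir a b := G.dir a b
  dir_irrefl a := G.dir_irrefl a
  bidir := G.bidir.induce s

/-- The induced subgraph `G_{-i}` on `V \ {i}`. -/
abbrev remove (G : MixedGraph V) (i : V) : MixedGraph ({i}ᶜ : Set V) := G.induce {i}ᶜ

/-- Half-collider paths: either all edges are bi-directed (possibly there is no edge at all), or
the first edge is directed, pointing away from the first vertex, and all other edges are
bi-directed. Vertices may be repeated. -/
inductive HalfColliderPath (G : MixedGraph V) : V → V → Type _
  | bidirected {a b : V} (w : G.bidir.Walk a b) : HalfColliderPath G a b
  | directed {a b c : V} (h : G.dir a b) (w : G.bidir.Walk b c) : HalfColliderPath G a c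

/-- The bi-directed portion: all vertices of the path, except for the starting point of the first
edge if that edge is directed (which may still occur later on the path). -/
def HalfColliderPath.bidirectedPortion {G : MixedGraph V} {a b : V} :
    G.HalfColliderPath a b → Set V
  | .bidirected w => {v | v ∈ w.support}
  | .directed _ w => {v | v ∈ w.support}

/-- A system of `s` half-collider paths from `Sb` to `Se`. -/
structure HalfColliderSystem (G : MixedGraph V) (Sb Se : Set V) (s : ℕ) where
  encard_source : Sb.encard = s
  encard_target : Se.encard = s
  first : Fin s → V
  last : Fin s → V
  path : ∀ l, G.HalfColliderPath (first l) (last l)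
  first_mem : ∀ l, first l ∈ Sb
  last_mem : ∀ l, last l ∈ Se
  exists_first : ∀ v ∈ Sb, ∃ l, first l = v
  exists_last : ∀ v ∈ Se, ∃ l, last l = v

/-- The graphical condition at the node `i`: the induced subgraph `G_{-i}` contains a system of
half-collider paths from a subset of `V \ (pa(i) ∪ {i})` to `sib(i)` with pairwise disjoint
bi-directed portions. -/
def HalfColliderConditionAt (G : MixedGraph V) (i : V) : Prop :=
  ∃ Sb : Set ({i}ᶜ : Set V), (∀ v ∈ Sb, (v : V) ∉ G.pa i) ∧
    ∃ (s : ℕ) (P : (G.remove i).HalfColliderSystem Sb {v | (v : V) ∈ G.sib i} s),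
      ∀ l m, l ≠ m → Disjoint (P.path l).bidirectedPortion (P.path m).bidirectedPortion

/-- The graphical condition at all nodes. -/
def HalfColliderCondition (G : MixedGraph V) : Prop :=
  ∀ i, G.HalfColliderConditionAt i

variable [Fintype V] [DecidableEq V]

/-- `𝐁(G)`. -/
def coefficients (G : MixedGraph V) : Set (Matrix V V ℝ) :=
  {B | IsUnit (1 - B) ∧ ∀ i j, ¬ G.dir j i → B i j = 0}

/-- `𝛀(G)`; the diagonal entries are not restricted. -/
def errorCovariances (G : MixedGraph V) : Set (Matrix V V ℝ) :=
  {Ω | Ω.PosDef ∧ ∀ i j, i ≠ j → ¬ G.bidir.Adj j i → Ω i j = 0}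

/-- The parameter space `𝐁(G) × 𝛀(G)`. -/
def parameters (G : MixedGraph V) : Set (Matrix V V ℝ × Matrix V V ℝ) :=
  G.coefficients ×ˢ G.errorCovariances

end MixedGraph

/-- The covariance matrix `(I - B)⁻¹ Ω (I - B)⁻ᵀ` determined by `θ = (B, Ω)`. -/
noncomputable def semCovariance {V : Type*} [Fintype V] [DecidableEq V]
    (θ : Matrix V V ℝ × Matrix V V ℝ) : Matrix V V ℝ :=
  (1 - θ.1)⁻¹ * θ.2 * ((1 - θ.1)⁻¹).transpose

/-- The normal distribution `N(0, (I - B)⁻¹ Ω (I - B)⁻ᵀ)` determined by `θ = (B, Ω)`. -/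
noncomputable def semDistribution {V : Type*} [Fintype V] [DecidableEq V]
    (θ : Matrix V V ℝ × Matrix V V ℝ) : MeasureTheory.Measure (EuclideanSpace ℝ V) :=
  ProbabilityTheory.multivariateGaussian 0 (semCovariance θ)

/-- The parameters of the linear structural equation model `𝐍(G)` are identifiable: distinct
parameter pairs define distinct distributions. -/
def MixedGraph.ParametersIdentifiable {V : Type*} [Fintype V] [DecidableEq V]
    (G : MixedGraph V) : Prop :=
  Set.InjOn semDistribution G.parameters

/-! The equations `(I - B) X = ε` of a model may be multiplied by any invertible matrix `N` without
changing the law of `X`. Take for `N` the operation that adds a combination `u` of all rows to row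
`i`: the zero patterns of `B` and `Ω` survive if `u (I - B)` is supported on `pa(i)` and `u Ω` on
`sib(i) ∪ {i}`. Since the multiples of `u` are then also allowed, one such `u ≠ 0` produces
infinitely many parameter pairs with the same covariance matrix.

If no such `u ≠ 0` exists, the rows of the matrix made of the columns of `Ω` outside `sib(i) ∪ {i}`
and the columns of `I - B` outside `pa(i)` are linearly independent. By Hall's marriage theorem its
rows can be injectively assigned columns in which they have nonzero entries. Every vertex is then
matched to itself or to a neighbour, and following the matching from the siblings of `i`, which no
vertex is matched to, until a column of `I - B` is reached traces, backwards, the half-collider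
paths required by the graphical condition at `i`. -/

lemma exists_injective_apply_ne_zero_of_linearIndependent {m n R : Type*} [Semiring R]
    [StrongRankCondition R] {v : m → n →₀ R} (hv : LinearIndependent R v) :
    ∃ f : m → n, Function.Injective f ∧ ∀ k, v k (f k) ≠ 0 := by
  classical
  have hall : ∀ s : Finset m, s.card ≤ (s.biUnion fun k => (v k).support).card := by
    intro s
    let b : Finset (n →₀ R) :=
      (s.biUnion fun k => (v k).support).image fun j => Finsupp.single j 1
    have hspan : Set.range (fun k : s => v k) ⊆ Submodule.span R (b : Set (n →₀ R)) := by
      rintro _ ⟨k, rfl⟩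
      rw [Finset.coe_image, ← Finsupp.supported_eq_span_single, SetLike.mem_coe,
        Finsupp.mem_supported]
      exact_mod_cast Finset.subset_biUnion_of_mem (fun k => (v k).support) k.2
    have hsb : s.card ≤ b.card := by
      simpa using linearIndependent_le_span_aux' (fun k : s => v k)
        (hv.comp _ Subtype.val_injective) (b : Set (n →₀ R)) hspan
    exact hsb.trans Finset.card_image_le
  simpa only [Finsupp.mem_support_iff] using
    (Finset.all_card_le_biUnion_card_iff_exists_injective fun k => (v k).support).1 hall

section SumMap

variable {α α' β β' : Type*} {g : α → α'} {h : β → β'} {x : α ⊕ β}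

lemma sumMap_eq_inl_iff {a : α'} : x.map g h = .inl a ↔ ∃ y, x = .inl y ∧ g y = a := by
  cases x <;> simp

lemma sumMap_eq_inr_iff {b : β'} : x.map g h = .inr b ↔ ∃ y, x = .inr y ∧ h y = b := by
  cases x <;> simp

end SumMap

section ReachesVia

variable {α β : Type*} {f : α → α ⊕ β} {a b c : α}

/-- `ReachesVia f a c` says that iterating the partial map `f` from `a` passes through `c`. Here
`f` is undefined at the points it sends to the right summand `β`; these values record where an
iteration stops. -/
def ReachesVia (f : α → α ⊕ β) : α → α → Prop :=
  Relation.ReflTransGen fun c d => f c = .inl d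

lemma ReachesVia.exists_eq_inr [Finite α] (hf : Function.Injective f)
    (ha : .inl a ∉ Set.range f) : ∃ c x, ReachesVia f a c ∧ f c = .inr x := by
  by_contra! h
  have hnext : ∀ c : {c // ReachesVia f a c}, ∃ d : {c // ReachesVia f a c}, f c = .inl d := by
    rintro ⟨c, hc⟩
    cases hfc : f c with
    | inl d => exact ⟨⟨d, hc.tail hfc⟩, rfl⟩
    | inr x => exact absurd hfc (h c x hc)
  choose next hnext using hnext
  have hinj : Function.Injective next := fun c d hcd =>
    Subtype.ext (hf (by rw [hnext, hnext, hcd]))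
  obtain ⟨c, hc⟩ := Finite.surjective_of_injective hinj ⟨a, .refl⟩
  exact ha ⟨c, by rw [hnext, hc]⟩

lemma ReachesVia.eq_of_notMem_range (ha : .inl a ∉ Set.range f) (h : ReachesVia f b a) :
    b = a := by
  rcases Relation.ReflTransGen.cases_tail h with h | ⟨c, -, hc⟩
  · exact h.symm
  · exact absurd ⟨c, hc⟩ ha

lemma ReachesVia.start_unique (hf : Function.Injective f) (ha : .inl a ∉ Set.range f)
    (hb : .inl b ∉ Set.range f) (hac : ReachesVia f a c) (hbc : ReachesVia f b c) : a = b := by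
  have hpred : Relator.RightUnique (Function.swap fun c d => f c = Sum.inl (β := β) d) :=
    fun _ _ _ hy hz => hf (hy.trans hz.symm)
  rcases Relation.ReflTransGen.total_of_right_unique hpred hac.swap hbc.swap with h | h
  · exact (ReachesVia.eq_of_notMem_range ha h.swap).symm
  · exact ReachesVia.eq_of_notMem_range hb h.swap

lemma ReachesVia.exists_walk {H : SimpleGraph α}
    (hH : ∀ c d, f c = .inl d → c = d ∨ H.Adj c d) (hac : ReachesVia f a c) :
    ∃ w : H.Walk c a, ∀ v ∈ w.support, ReachesVia f a v := by
  induction hac with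
  | refl => exact ⟨.nil, fun v hv => by simp_all [ReachesVia, Relation.ReflTransGen.refl]⟩
  | @tail c d hac hcd ih =>
    obtain ⟨w, hw⟩ := ih
    rcases hH c d hcd with rfl | hadj
    · exact ⟨w, hw⟩
    · refine ⟨.cons hadj.symm w, fun v hv => ?_⟩
      rw [SimpleGraph.Walk.support_cons, List.mem_cons] at hv
      rcases hv with rfl | hv
      · exact hac.tail hcd
      · exact hw v hv

end ReachesVia

namespace MixedGraph

section Systems

variable {U : Type*} {G : MixedGraph U}

/-- The graph `G` contains a system of half-collider paths from a subset of `W` to `S` with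
pairwise disjoint bi-directed portions. -/
def HasDisjointHalfColliderSystem (G : MixedGraph U) (W S : Set U) : Prop :=
  ∃ Sb ⊆ W, ∃ (s : ℕ) (P : G.HalfColliderSystem Sb S s),
    ∀ l m, l ≠ m → Disjoint (P.path l).bidirectedPortion (P.path m).bidirectedPortion

/-- The system formed by one half-collider path into each node of `S`, when the first nodes of
these paths are distinct. -/
def HalfColliderSystem.ofInjective {S : Set U} {t : S → U} (ht : Function.Injective t)
    (p : ∀ a, G.HalfColliderPath (t a) a) {s : ℕ} (e : Fin s ≃ S) :
    G.HalfColliderSystem (Set.range t) S s where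
  encard_source := by
    simp [← Set.image_univ, ht.encard_image, ← ENat.card_congr e]
  encard_target := by simp [← ENat.card_coe_set_eq, ← ENat.card_congr e]
  first l := t (e l)
  last l := e l
  path l := p (e l)
  first_mem _ := Set.mem_range_self _
  last_mem l := (e l).2
  exists_first := by
    rintro _ ⟨a, rfl⟩
    exact ⟨e.symm a, by rw [e.apply_symm_apply]⟩
  exists_last v hv := ⟨e.symm ⟨v, hv⟩, by rw [e.apply_symm_apply]⟩

/-- A half-collider matching of `G`: an injection `f` that matches each vertex `c` to itself, to a
sibling of `c`, or to a parent of `c`. The left summand of `U ⊕ U` indexes bi-directed matches (the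
columns of `Ω`), the right summand directed ones (the columns of `I - B`); a vertex can be matched
to itself in either way. -/
structure IsHalfColliderMatching (G : MixedGraph U) (f : U → U ⊕ U) : Prop where
  injective : Function.Injective f
  eq_or_adj : ∀ c d, f c = .inl d → c = d ∨ G.bidir.Adj c d
  eq_or_dir : ∀ c d, f c = .inr d → c = d ∨ G.dir d c

variable {f : U → U ⊕ U}

lemma IsHalfColliderMatching.exists_halfColliderPath [Finite U] (hf : G.IsHalfColliderMatching f)
    {a : U} (ha : .inl a ∉ Set.range f) :
    ∃ (t : U) (p : G.HalfColliderPath t a), (∃ c, ReachesVia f a c ∧ f c = .inr t) ∧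
      ∀ v ∈ p.bidirectedPortion, ReachesVia f a v := by
  obtain ⟨c, t, hac, hct⟩ := ReachesVia.exists_eq_inr hf.injective ha
  obtain ⟨w, hw⟩ := hac.exists_walk hf.eq_or_adj
  rcases hf.eq_or_dir c t hct with rfl | hdir
  · exact ⟨c, .bidirected w, ⟨c, hac, hct⟩, hw⟩
  · exact ⟨t, .directed hdir w, ⟨c, hac, hct⟩, hw⟩

lemma IsHalfColliderMatching.hasDisjointHalfColliderSystem [Finite U]
    (hf : G.IsHalfColliderMatching f) {W S : Set U} (hW : ∀ t, .inr t ∈ Set.range f → t ∈ W)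
    (hS : ∀ a ∈ S, .inl a ∉ Set.range f) : G.HasDisjointHalfColliderSystem W S := by
  choose t p ht hp using fun a : S => hf.exists_halfColliderPath (hS a a.2)
  have start_unique {a b : S} {c : U} (hac : ReachesVia f a c) (hbc : ReachesVia f b c) : a = b :=
    Subtype.ext (hac.start_unique hf.injective (hS a a.2) (hS b b.2) hbc)
  have ht_inj : Function.Injective t := by
    intro a b hab
    obtain ⟨c, hac, hc⟩ := ht a
    obtain ⟨d, hbd, hd⟩ := ht b
    obtain rfl : c = d := hf.injective (by rw [hc, hd, hab])
    exact start_unique hac hbd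
  refine ⟨Set.range t, ?_, Nat.card S, .ofInjective ht_inj p (Finite.equivFin S).symm, ?_⟩
  · rintro _ ⟨a, rfl⟩
    obtain ⟨c, -, hc⟩ := ht a
    exact hW _ ⟨c, hc⟩
  · intro l m hlm
    rw [Set.disjoint_left]
    exact fun v hl hm => hlm ((Finite.equivFin S).symm.injective
      (start_unique (hp _ v hl) (hp _ v hm)))

lemma IsHalfColliderMatching.exists_induce (hf : G.IsHalfColliderMatching f) {s : Set U}
    (hs : ∀ c : s, f c ∈ Set.range (Sum.map ((↑) : s → U) ((↑) : s → U))) :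
    ∃ g : s → s ⊕ s, (G.induce s).IsHalfColliderMatching g ∧
      ∀ c, (g c).map (↑) (↑) = f c := by
  choose g hg using hs
  refine ⟨g, ⟨fun c d hcd => ?_, fun c d hcd => ?_, fun c d hcd => ?_⟩, hg⟩
  · exact Subtype.ext (hf.injective (by rw [← hg, ← hg, hcd]))
  · exact (hf.eq_or_adj c d (by rw [← hg, hcd, Sum.map_inl])).imp_left Subtype.ext
  · exact (hf.eq_or_dir c d (by rw [← hg, hcd, Sum.map_inr])).imp_left Subtype.ext

lemma IsHalfColliderMatching.halfColliderConditionAt [Finite U] {i : U}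
    (hf : G.IsHalfColliderMatching f) (hsib : ∀ j, .inl j ∈ Set.range f → j ≠ i ∧ j ∉ G.sib i)
    (hpa : ∀ j, .inr j ∈ Set.range f → j ∉ G.pa i) : G.HalfColliderConditionAt i := by
  have hfi : f i = .inr i := by
    cases h : f i with
    | inl j =>
      obtain ⟨hji, hj⟩ := hsib j ⟨i, h⟩
      exact absurd (hf.eq_or_adj i j h) (not_or.2 ⟨hji.symm, fun hadj => hj hadj.symm⟩)
    | inr j =>
      rw [(hf.eq_or_dir i j h).resolve_right (hpa j ⟨i, h⟩)]
  have hrestrict : ∀ c : ({i}ᶜ : Set U), f c ∈ Set.range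
      (Sum.map ((↑) : ({i}ᶜ : Set U) → U) ((↑) : ({i}ᶜ : Set U) → U)) := by
    intro c
    cases h : f c with
    | inl j => exact ⟨.inl ⟨j, (hsib j ⟨c, h⟩).1⟩, rfl⟩
    | inr j =>
      have hji : j ≠ i := by
        rintro rfl
        exact c.2 (hf.injective (h.trans hfi.symm))
      exact ⟨.inr ⟨j, hji⟩, rfl⟩
  obtain ⟨g, hg, hgf⟩ := hf.exists_induce hrestrict
  refine hg.hasDisjointHalfColliderSystem (W := {v | (v : U) ∉ G.pa i}) ?_ ?_
  · rintro t ⟨c, hc⟩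
    exact hpa t ⟨c, by rw [← hgf, hc, Sum.map_inr]⟩
  · rintro a ha ⟨c, hc⟩
    exact (hsib a ⟨c, by rw [← hgf, hc, Sum.map_inl]⟩).2 ha

end Systems

end MixedGraph

section AddToRow

open scoped Matrix

variable {n R : Type*} [DecidableEq n]

lemma vecMulVec_single_one_apply_eq_zero [MulZeroOneClass R] {i a b : n} {x : n → R}
    (h : a = i → x b = 0) :
    Matrix.vecMulVec (Pi.single i 1) x a b = 0 := by
  rw [Matrix.vecMulVec_apply, Pi.single_apply]
  split_ifs with hai
  · rw [h hai, mul_zero]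
  · rw [zero_mul]

/-- The matrix that adds the combination `u ᵥ* M` of all rows of `M` to the `i`-th row when it
multiplies `M` from the left. -/
def addToRow [Semiring R] (i : n) (u : n → R) : Matrix n n R :=
  1 + Matrix.vecMulVec (Pi.single i 1) u

lemma addToRow_injective [Ring R] (i : n) :
    Function.Injective (addToRow i : (n → R) → Matrix n n R) := by
  intro u u' h
  funext j
  have hij : addToRow i u i j = addToRow i u' i j := by rw [h]
  simpa [addToRow, Matrix.vecMulVec_apply] using hij

variable [Fintype n]

lemma isUnit_addToRow [CommRing R] {i : n} {u : n → R} (hu : IsUnit (1 + u i)) :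
    IsUnit (addToRow i u) := by
  rwa [Matrix.isUnit_iff_isUnit_det, addToRow, Matrix.vecMulVec_eq Unit,
    Matrix.det_one_add_replicateCol_mul_replicateRow, dotProduct_single, mul_one]

lemma addToRow_mul [Semiring R] (i : n) (u : n → R) (M : Matrix n n R) :
    addToRow i u * M = M + Matrix.vecMulVec (Pi.single i 1) (u ᵥ* M) := by
  rw [addToRow, add_mul, one_mul, Matrix.vecMulVec_mul]

lemma addToRow_mul_mul_transpose [CommSemiring R] (i : n) (u : n → R) (M : Matrix n n R) :
    addToRow i u * M * (addToRow i u)ᵀ =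
      M + Matrix.vecMulVec (Pi.single i 1) (u ᵥ* M) + Matrix.vecMulVec (M *ᵥ u) (Pi.single i 1) +
        (u ᵥ* M ⬝ᵥ u) • Matrix.vecMulVec (Pi.single i 1) (Pi.single i 1) := by
  rw [addToRow_mul, addToRow, Matrix.transpose_add, Matrix.transpose_one,
    Matrix.transpose_vecMulVec, mul_add, mul_one, add_mul, Matrix.mul_vecMulVec,
    Matrix.vecMulVec_mul_vecMulVec, Matrix.vecMulVec_smul, ← add_assoc]

end AddToRow

section TransformEquations

open scoped Matrix

variable {V : Type*} [Fintype V] [DecidableEq V] {N : Matrix V V ℝ}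
  {θ : Matrix V V ℝ × Matrix V V ℝ}

/-- The parameter pair obtained from `(B, Ω)` by multiplying the structural equations
`(I - B) X = ε`, where `ε` has covariance matrix `Ω`, by `N` from the left. -/
def transformEquations (N : Matrix V V ℝ) (θ : Matrix V V ℝ × Matrix V V ℝ) :
    Matrix V V ℝ × Matrix V V ℝ :=
  (1 - N * (1 - θ.1), N * θ.2 * Nᵀ)

lemma semCovariance_transformEquations (hN : IsUnit N) :
    semCovariance (transformEquations N θ) = semCovariance θ := by
  have hN_det : IsUnit N.det := (Matrix.isUnit_iff_isUnit_det N).1 hN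
  have hNt_det : IsUnit Nᵀ.det := Matrix.isUnit_det_transpose N hN_det
  simp only [semCovariance, transformEquations, sub_sub_cancel, Matrix.transpose_mul,
    Matrix.transpose_nonsing_inv, Matrix.mul_inv_rev, Matrix.mul_assoc]
  rw [Matrix.mul_nonsing_inv_cancel_left _ _ hNt_det,
    Matrix.nonsing_inv_mul_cancel_left _ _ hN_det]

lemma transformEquations_left_injective (hθ : IsUnit (1 - θ.1)) :
    Function.Injective fun N => transformEquations N θ := fun _ _ h =>
  hθ.mul_left_injective (sub_right_injective (Prod.ext_iff.1 h).1)

end TransformEquations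

namespace MixedGraph

section RowDirections

open scoped Matrix

variable {V : Type*} [Fintype V] [DecidableEq V] {G : MixedGraph V} {i : V}
  {θ : Matrix V V ℝ × Matrix V V ℝ} {u : V → ℝ}

/-- The row vectors `u` such that adding the combination `u` of all structural equations to the
`i`-th one respects the zero patterns of `G` at the parameter pair `θ = (B, Ω)`. -/
structure IsRowDirection (G : MixedGraph V) (i : V) (θ : Matrix V V ℝ × Matrix V V ℝ)
    (u : V → ℝ) : Prop where
  vecMul_one_sub : ∀ j ∉ G.pa i, (u ᵥ* (1 - θ.1)) j = 0
  vecMul_errorCovariance : ∀ j, j ≠ i → j ∉ G.sib i → (u ᵥ* θ.2) j = 0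

lemma IsRowDirection.smul (hu : G.IsRowDirection i θ u) (t : ℝ) :
    G.IsRowDirection i θ (t • u) where
  vecMul_one_sub j hj := by
    rw [Matrix.smul_vecMul, Pi.smul_apply, hu.vecMul_one_sub j hj, smul_zero]
  vecMul_errorCovariance j hji hj := by
    rw [Matrix.smul_vecMul, Pi.smul_apply, hu.vecMul_errorCovariance j hji hj, smul_zero]

lemma IsRowDirection.fst_mem_coefficients (hu : G.IsRowDirection i θ u) (hui : 1 + u i ≠ 0)
    (hθ : θ.1 ∈ G.coefficients) :
    (transformEquations (addToRow i u) θ).1 ∈ G.coefficients := by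
  refine ⟨?_, fun a b hab => ?_⟩
  · simpa only [transformEquations, sub_sub_cancel] using
      (isUnit_addToRow hui.isUnit).mul hθ.1
  · simp only [transformEquations, addToRow_mul, ← sub_sub, sub_sub_cancel]
    rw [Matrix.sub_apply, hθ.2 a b hab, vecMulVec_single_one_apply_eq_zero, sub_zero]
    rintro rfl
    exact hu.vecMul_one_sub b hab

lemma IsRowDirection.snd_mem_errorCovariances (hu : G.IsRowDirection i θ u) (hui : 1 + u i ≠ 0)
    (hθ : θ.2 ∈ G.errorCovariances) :
    (transformEquations (addToRow i u) θ).2 ∈ G.errorCovariances := by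
  have hsymm : θ.2.IsSymm := by simpa using hθ.1.isHermitian
  refine ⟨?_, fun a b hab hadj => ?_⟩
  · simpa [transformEquations] using hθ.1.mul_mul_conjTranspose_same
      (Matrix.vecMul_injective_of_isUnit (isUnit_addToRow hui.isUnit))
  · have hrow : Matrix.vecMulVec (Pi.single i 1) (u ᵥ* θ.2) a b = 0 :=
      vecMulVec_single_one_apply_eq_zero fun hai =>
        hu.vecMul_errorCovariance b (hai ▸ hab.symm) (hai ▸ hadj)
    have hcol : Matrix.vecMulVec (θ.2 *ᵥ u) (Pi.single i 1) a b = 0 := by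
      rw [← Matrix.transpose_vecMulVec, Matrix.transpose_apply, ← hsymm.eq, Matrix.mulVec_transpose]
      exact vecMulVec_single_one_apply_eq_zero fun hbi =>
        hu.vecMul_errorCovariance a (hbi ▸ hab) fun h => hadj (hbi ▸ h.symm)
    have hdiag : Matrix.vecMulVec (Pi.single i 1) (Pi.single i (1 : ℝ)) a b = 0 :=
      vecMulVec_single_one_apply_eq_zero fun hai => Pi.single_eq_of_ne (hai ▸ hab.symm) 1
    simp only [transformEquations, addToRow_mul_mul_transpose, Matrix.add_apply,
      Matrix.smul_apply, hθ.2 a b hab hadj, hrow, hcol, hdiag, smul_zero, add_zero]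

lemma IsRowDirection.infinite_setOf_semCovariance_eq (hu : G.IsRowDirection i θ u) (hu0 : u ≠ 0)
    (hθ : θ ∈ G.parameters) :
    {θ' ∈ G.parameters | semCovariance θ' = semCovariance θ}.Infinite := by
  have hinj : Function.Injective fun t : ℝ => transformEquations (addToRow i (t • u)) θ :=
    (transformEquations_left_injective hθ.1.1).comp
      ((addToRow_injective i).comp (smul_left_injective ℝ hu0))
  have hinf : {t : ℝ | 1 + (t • u) i = 0}ᶜ.Infinite := by
    refine Set.Finite.infinite_compl ((Set.finite_singleton (-(u i)⁻¹)).subset fun t ht => ?_)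
    have htu : -t * u i = 1 := by
      rw [Set.mem_ofPred_eq, Pi.smul_apply, smul_eq_mul] at ht
      linarith
    rw [Set.mem_singleton_iff, ← eq_inv_of_mul_eq_one_left htu, neg_neg]
  exact Set.infinite_of_injOn_mapsTo hinj.injOn (fun t ht =>
    ⟨⟨(hu.smul t).fst_mem_coefficients ht hθ.1, (hu.smul t).snd_mem_errorCovariances ht hθ.2⟩,
      semCovariance_transformEquations (isUnit_addToRow (IsUnit.mk0 _ ht))⟩) hinf

/-- The matrix whose columns are the columns of `Ω` outside `sib(i) ∪ {i}` and the columns of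
`I - B` outside `pa(i)`; its left kernel consists of the row directions at `i`. -/
def constraintMatrix (G : MixedGraph V) (i : V) (θ : Matrix V V ℝ × Matrix V V ℝ) :
    Matrix V ({j // j ≠ i ∧ j ∉ G.sib i} ⊕ {j // j ∉ G.pa i}) ℝ :=
  Matrix.fromCols (θ.2.submatrix id (↑)) ((1 - θ.1).submatrix id (↑))

lemma isRowDirection_of_vecMul_constraintMatrix_eq_zero (hu : u ᵥ* G.constraintMatrix i θ = 0) :
    G.IsRowDirection i θ u where
  vecMul_one_sub j hj := congrFun hu (.inr ⟨j, hj⟩)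
  vecMul_errorCovariance j hji hj := congrFun hu (.inl ⟨j, hji, hj⟩)

lemma isHalfColliderMatching_of_constraintMatrix_ne_zero (hθ : θ ∈ G.parameters)
    {f : V → {j // j ≠ i ∧ j ∉ G.sib i} ⊕ {j // j ∉ G.pa i}} (hf : Function.Injective f)
    (hne : ∀ k, G.constraintMatrix i θ k (f k) ≠ 0) :
    G.IsHalfColliderMatching fun k => (f k).map (↑) (↑) where
  injective := (Subtype.val_injective.sumMap Subtype.val_injective).comp hf
  eq_or_adj c d hcd := by
    obtain ⟨j, hj, rfl⟩ := sumMap_eq_inl_iff.1 hcd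
    by_contra! hc
    refine hne c ?_
    simp [hj, constraintMatrix, hθ.2.2 c j hc.1 fun h => hc.2 h.symm]
  eq_or_dir c d hcd := by
    obtain ⟨j, hj, rfl⟩ := sumMap_eq_inr_iff.1 hcd
    by_contra! hc
    refine hne c ?_
    simp [hj, constraintMatrix, hc.1, hθ.1.2 c j hc.2]

lemma exists_isRowDirection_of_not_halfColliderConditionAt (hi : ¬ G.HalfColliderConditionAt i)
    (hθ : θ ∈ G.parameters) : ∃ u ≠ 0, G.IsRowDirection i θ u := by
  contrapose! hi
  have hrows : LinearIndependent ℝ (G.constraintMatrix i θ).row := by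
    rw [← Matrix.vecMul_injective_iff, ← Matrix.coe_vecMulLinear,
      injective_iff_map_eq_zero]
    intro u hu
    by_contra hu0
    exact hi u hu0 (isRowDirection_of_vecMul_constraintMatrix_eq_zero hu)
  obtain ⟨f, hf, hne⟩ := exists_injective_apply_ne_zero_of_linearIndependent
    (hrows.map' _ (Finsupp.linearEquivFunOnFinite ℝ ℝ _).symm.ker)
  refine (isHalfColliderMatching_of_constraintMatrix_ne_zero hθ hf hne).halfColliderConditionAt
    ?_ ?_
  · rintro _ ⟨k, hk⟩
    obtain ⟨j, -, rfl⟩ := sumMap_eq_inl_iff.1 hk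
    exact j.2
  · rintro _ ⟨k, hk⟩
    obtain ⟨j, -, rfl⟩ := sumMap_eq_inr_iff.1 hk
    exact j.2

end RowDirections

section Parameters

variable {V : Type*} [Fintype V] [DecidableEq V] {G : MixedGraph V}

lemma parameters_nonempty (G : MixedGraph V) : G.parameters.Nonempty :=
  ⟨(0, 1), ⟨by simp, fun _ _ _ => rfl⟩, Matrix.PosDef.one, fun _ _ h _ => Matrix.one_apply_ne h⟩

lemma ParametersIdentifiable.subsingleton_setOf_semCovariance_eq (hG : G.ParametersIdentifiable)
    (θ : Matrix V V ℝ × Matrix V V ℝ) :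
    {θ' ∈ G.parameters | semCovariance θ' = semCovariance θ}.Subsingleton :=
  fun _ h _ h' => hG h.1 h'.1 (by rw [semDistribution, semDistribution, h.2, h'.2])

end Parameters

end MixedGraph

theorem mainTheorem7 {V : Type*} [Fintype V] [DecidableEq V] (G : MixedGraph V)
    (hG : ¬ G.HalfColliderCondition) :
    ¬ G.ParametersIdentifiable ∧
      ∀ θ ∈ G.parameters,
        {θ' ∈ G.parameters | semCovariance θ' = semCovariance θ}.Infinite := by
  obtain ⟨i, hi⟩ := not_forall.1 hG
  have infinite_fiber : ∀ θ ∈ G.parameters,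
      {θ' ∈ G.parameters | semCovariance θ' = semCovariance θ}.Infinite := by
    intro θ hθ
    obtain ⟨u, hu0, hu⟩ :=
      MixedGraph.exists_isRowDirection_of_not_halfColliderConditionAt hi hθ
    exact hu.infinite_setOf_semCovariance_eq hu0 hθ
  obtain ⟨θ, hθ⟩ := G.parameters_nonempty
  refine ⟨fun hid => infinite_fiber θ hθ ?_, infinite_fiber⟩
  exact (hid.subsingleton_setOf_semCovariance_eq θ).finite
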